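/- All groups are finite. For a group $G$, an integer $m\ge 1$ and $u,g\in G$ put $G_m(u,g)=\{a\in G: a^m=(au)^m=g\}$. The group $G$ is called $FSZ_m$ if $|G_m(u,g)|=|G_m(u,g^n)|$ for all $u,g\in G$ and all positive integers $n$ coprime to $|G|$. Given central subgroups $A\le Z(G)$, $B\le Z(H)$ and an isomorphism $\varphi\colon A\to B$, the corresponding central product is $G\ast H=(G\times H)/\{(a,\varphi(a^{-1})):a\in A\}$. Let $p$ be a prime and $j\ge 1$ an integer. Let $Q_{p,j}=\mathbb{Z}_{p^{j+1}}\times\mathbb{Z}_p^{\,p^j-1}$ with generators $a_1,\dots,a_{p^j}$, where $a_1$ has order $p^{j+1}$ and the others have order $p$, let $b=b_{p,j}$ be the automorphism of $Q_{p,j}$ with $a_1\mapsto a_1a_2^{-1}$, $a_k\mapsto a_ka_{k+1}$ for $2\le k<p^j$, and $a_{p^j}\mapsto a_{p^j}$, and let $F(p,j)=Q_{p,j}\rtimes\langle b\rangle$. For $p$ odd, let likewise $P_{p,j}=\mathbb{Z}_{p^{j+1}}\times\mathbb{Z}_p^{\,p^j-2}$ with generators $a_1,\dots,a_{p^j-1}$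 ($a_1$ of order $p^{j+1}$, the others of order $p$), let $c$ be the automorphism of $P_{p,j}$ with $a_1\mapsto a_1a_2^{-1}$, $a_k\mapsto a_ka_{k+1}$ for $2\le k<p^j-1$, and $a_{p^j-1}\mapsto a_{p^j-1}a_1^{-p^j}$, and let $S(p,j)=P_{p,j}\rtimes\langle c\rangle$. Theorem. Let $p$ be a prime and $j\ge1$. Then: 1. $F(p,j)$ is $FSZ_{p^j}$. 2. If $p>3$, then $F(p,j)$ has a central subgroup $A\cong\mathbb{Z}_p$ such that $F(p,j)/A\cong S(p,j)$ and $F(p,j)/A$ is not $FSZ_{p^j}$. 3. If $p>3$, then for every cyclic group $C$ of order $p^{j+1}$ there exists a central product $F(p,j)\ast C$ that is not $FSZ_{p^j}$. -/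

import Mathlib

namespace FSZ

/-- The set `G_m(u, g) = {a ∈ G : a ^ m = (a u) ^ m = g}`. -/
def powSet {G : Type*} [Group G] (m : ℕ) (u g : G) : Set G :=
  {a | a ^ m = g ∧ (a * u) ^ m = g}

/-- The (finite) group `G` is `FSZ_m`: for every positive integer `n` coprime to `|G|`
one has `|G_m(u, g)| = |G_m(u, g ^ n)|` for all `u, g ∈ G`. -/
def IsFSZ (m : ℕ) (G : Type*) [Group G] : Prop :=
  ∀ n : ℕ, 0 < n → n.Coprime (Nat.card G) →
    ∀ u g : G, (powSet m u g).ncard = (powSet m u (g ^ n)).ncard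

section CentralProduct

variable {G H : Type*} [Group G] [Group H]

/-- The subgroup `N = {(a, φ(a⁻¹)) : a ∈ A}` of `G × H`, for central subgroups `A` of `G` and
`B` of `H` and an isomorphism `φ : A ≃ B`. -/
def centralKernel {A : Subgroup G} {B : Subgroup H} (hA : A ≤ Subgroup.center G)
    (_hB : B ≤ Subgroup.center H) (φ : A ≃* B) : Subgroup (G × H) where
  carrier := {x | ∃ a : A, x = ((a : G), (φ a⁻¹ : H))}
  one_mem' := ⟨1, by ext <;> simp⟩
  mul_mem' := by
    rintro _ _ ⟨a, rfl⟩ ⟨c, rfl⟩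
    have hc : a * c = c * a := Subtype.ext ((Subgroup.mem_center_iff.mp (hA c.2)) a)
    refine ⟨a * c, ?_⟩
    ext
    · simp
    · rw [hc]; simp
  inv_mem' := by
    rintro _ ⟨a, rfl⟩
    exact ⟨a⁻¹, by ext <;> simp⟩

instance centralKernel_normal {A : Subgroup G} {B : Subgroup H} (hA : A ≤ Subgroup.center G)
    (hB : B ≤ Subgroup.center H) (φ : A ≃* B) : (centralKernel hA hB φ).Normal where
  conj_mem := by
    rintro _ ⟨a, rfl⟩ ⟨g, h⟩
    have h1 := Subgroup.mem_center_iff.mp (hA a.2) g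
    have h2 := Subgroup.mem_center_iff.mp (hB (φ a⁻¹).2) h
    refine ⟨a, ?_⟩
    ext
    · simp only [Prod.fst_mul, Prod.fst_inv]
      rw [h1, mul_inv_cancel_right]
    · simp only [Prod.snd_mul, Prod.snd_inv]
      rw [h2, mul_inv_cancel_right]

/-- The central product `G ∗ H = (G × H) / N` determined by `A`, `B` and `φ`. -/
abbrev CentralProduct {A : Subgroup G} {B : Subgroup H} (hA : A ≤ Subgroup.center G)
    (hB : B ≤ Subgroup.center H) (φ : A ≃* B) : Type _ :=
  (G × H) ⧸ centralKernel hA hB φ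

end CentralProduct

/-- The abelian group `ℤ/p^(j+1) × (ℤ/p)^n`, written additively. The element `(x, v)` is
`a₁^x a₂^(v 0) a₃^(v 1) ⋯ a_(n+1)^(v (n-1))`. -/
abbrev Ab (p j n : ℕ) : Type := ZMod (p ^ (j + 1)) × (Fin n → ZMod p)

/-- Reduction `ℤ/p^(j+1) → ℤ/p`. -/
def red (p j : ℕ) : ZMod (p ^ (j + 1)) →+ ZMod p :=
  (ZMod.castHom (dvd_pow_self p (Nat.succ_ne_zero j)) (ZMod p)).toAddMonoidHom

/-- The embedding `ℤ/p → ℤ/p^(j+1)`, `t ↦ p^j t`. -/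
def emb (p j : ℕ) : ZMod p →+ ZMod (p ^ (j + 1)) :=
  ZMod.lift p ⟨(AddMonoidHom.mulLeft ((p : ZMod (p ^ (j + 1))) ^ j)).comp
    (Int.castAddHom (ZMod (p ^ (j + 1)))), by
      have h : ((p ^ (j + 1) : ℕ) : ZMod (p ^ (j + 1))) = 0 := ZMod.natCast_self _
      have h' : (p : ZMod (p ^ (j + 1))) ^ j * (p : ZMod (p ^ (j + 1))) = 0 := by
        rw [← pow_succ, ← Nat.cast_pow]
        exact h
      simpa using h'⟩

/-- The exponents of `a₂, …, a_(n+1)` after applying `a₁ ↦ a₁ a₂⁻¹` and `a_k ↦ a_k a_(k+1)`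
for `2 ≤ k ≤ n`. -/
def shift (p j n : ℕ) : Ab p j n →+ (Fin n → ZMod p) where
  toFun y i :=
    match i with
    | ⟨0, h⟩ => y.2 ⟨0, h⟩ - red p j y.1
    | ⟨k + 1, h⟩ => y.2 ⟨k + 1, h⟩ + y.2 ⟨k, Nat.lt_of_succ_lt h⟩
  map_zero' := by
    funext ⟨i, hi⟩
    cases i <;> simp
  map_add' := by
    intro x y
    funext ⟨i, hi⟩
    cases i
    · simp; ring
    · simp; ring

/-- The exponent of the last generator `a_(n+1)` (zero if `n = 0`). -/
def last (p j n : ℕ) : Ab p j n →+ ZMod p where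
  toFun y := if h : 0 < n then y.2 ⟨n - 1, Nat.sub_one_lt_of_lt h⟩ else 0
  map_zero' := by simp
  map_add' := by
    intro x y
    by_cases h : 0 < n <;> simp [h]

/-- The abelian group `Q_{p,j} = ℤ/p^(j+1) × (ℤ/p)^(p^j-1)` with generators `a₁, …, a_(p^j)`. -/
abbrev Q (p j : ℕ) : Type := Ab p j (p ^ j - 1)

/-- The endomorphism of `Q_{p,j}` given by `a₁ ↦ a₁ a₂⁻¹`, `a_k ↦ a_k a_(k+1)` for
`2 ≤ k < p^j`, and `a_(p^j) ↦ a_(p^j)`. -/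
def bEnd (p j : ℕ) : Q p j →+ Q p j :=
  (AddMonoidHom.fst _ _).prod (shift p j (p ^ j - 1))

/-- The abelian group `P_{p,j} = ℤ/p^(j+1) × (ℤ/p)^(p^j-2)` with generators
`a₁, …, a_(p^j-1)`. -/
abbrev P (p j : ℕ) : Type := Ab p j (p ^ j - 2)

/-- The endomorphism of `P_{p,j}` (for `p` odd and `j ≥ 1`) given by `a₁ ↦ a₁ a₂⁻¹`,
`a_k ↦ a_k a_(k+1)` for `2 ≤ k < p^j - 1`, and `a_(p^j-1) ↦ a_(p^j-1) a₁^(-p^j)`. -/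
def cEnd (p j : ℕ) : P p j →+ P p j :=
  (AddMonoidHom.fst _ _ - (emb p j).comp (last p j (p ^ j - 2))).prod (shift p j (p ^ j - 2))

theorem red_emb (p j : ℕ) (hj : 0 < j) (t : ZMod p) : red p j (emb p j t) = 0 := by
  obtain ⟨k, rfl⟩ := ZMod.intCast_surjective t
  simp [emb, red, hj.ne']

theorem snd_eq_zero_of_shift {p j n : ℕ} {y : Ab p j n} (h : shift p j n y = 0)
    (h0 : red p j y.1 = 0) : y.2 = 0 := by
  have key : ∀ (k : ℕ) (hk : k < n), y.2 ⟨k, hk⟩ = 0 := by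
    intro k
    induction k with
    | zero =>
      intro hk
      have := congrFun h ⟨0, hk⟩
      simpa [shift, h0] using this
    | succ k ih =>
      intro hk
      have := congrFun h ⟨k + 1, hk⟩
      simpa [shift, ih (Nat.lt_of_succ_lt hk)] using this
  funext ⟨k, hk⟩
  exact key k hk

theorem bEnd_injective (p j : ℕ) : Function.Injective (bEnd p j) := by
  rw [injective_iff_map_eq_zero]
  intro y hy
  have h1 : y.1 = 0 := congrArg Prod.fst hy
  have h2 : shift p j _ y = 0 := congrArg Prod.snd hy
  exact Prod.ext h1 (snd_eq_zero_of_shift h2 (by simp [h1]))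

theorem cEnd_injective (p j : ℕ) : Function.Injective (cEnd p j) := by
  rw [injective_iff_map_eq_zero]
  intro y hy
  have h1 : y.1 - emb p j (last p j _ y) = 0 := congrArg Prod.fst hy
  have h2 : shift p j _ y = 0 := congrArg Prod.snd hy
  have h0 : red p j y.1 = 0 := by
    rw [sub_eq_zero.mp h1]
    rcases Nat.eq_zero_or_pos j with rfl | hj
    · have hl : last p 0 (p ^ 0 - 2) y = 0 := rfl
      rw [hl, map_zero, map_zero]
    · exact red_emb p j hj _
  have h3 := snd_eq_zero_of_shift h2 h0
  refine Prod.ext ?_ h3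
  rw [sub_eq_zero.mp h1]
  simp [last, h3]

/-- The automorphism `b_{p,j}` of `Q_{p,j}` (written multiplicatively). -/
noncomputable def b (p j : ℕ) [NeZero p] : MulAut (Multiplicative (Q p j)) :=
  AddEquiv.toMultiplicative (AddEquiv.ofBijective (bEnd p j)
    (Finite.injective_iff_bijective.mp (bEnd_injective p j)))

/-- The automorphism of `P_{p,j}` (written multiplicatively) that defines `S(p,j)`. -/
noncomputable def c (p j : ℕ) [NeZero p] : MulAut (Multiplicative (P p j)) :=
  AddEquiv.toMultiplicative (AddEquiv.ofBijective (cEnd p j)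
    (Finite.injective_iff_bijective.mp (cEnd_injective p j)))

/-- The group `F(p,j) = Q_{p,j} ⋊ ⟨b_{p,j}⟩`. -/
abbrev F (p j : ℕ) [NeZero p] : Type :=
  Multiplicative (Q p j) ⋊[(Subgroup.zpowers (b p j)).subtype] Subgroup.zpowers (b p j)

/-- The group `S(p,j) = P_{p,j} ⋊ ⟨c_{p,j}⟩`. -/
abbrev S (p j : ℕ) [NeZero p] : Type :=
  Multiplicative (P p j) ⋊[(Subgroup.zpowers (c p j)).subtype] Subgroup.zpowers (c p j)

end FSZ

/-!
Write `d = b - 1` in the endomorphism ring of `Q_{p,j}`. On the exponents of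
`a₁⁻¹, a₂, …, a_(p^j)` modulo `p` it acts as a shift, so `p d = 0`, `d ^ (p^j) = 0`, and
`d ^ (p^j - 1)` sends `a₁` to `a_(p^j)⁻¹` and kills the other generators. Since the binomial
coefficients of `p^j` other than the two extreme ones are divisible by `p`,
`∑_{i < p^j} b^(k i) = p^j + k^(p^j - 1) d^(p^j - 1)` (`geom_sum_pow_one_add`). Hence an element
`f = a₁^x ⋯ b^k` of `F(p,j)` satisfies `f^(p^j) = a₁^(x p^j) a_(p^j)^(-ε x)`, where `ε` is `0`
if `p` divides `k` and `1` otherwise (`pow_prime_pow_eq`). These powers are central, and both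
`x` modulo `p` and `k` modulo `p` are additive in `f`, so the whole question concerns the pairs
`(x, ε)`.

* In `F(p,j)` the power determines `x`, and multiplying `x` by `n` without touching `k` raises it
  to the power `n`. Left multiplication by a power of `a₁` therefore maps `G_(p^j)(u, g)` into
  `G_(p^j)(u, g^n)` (`ncard_powSet_le`), and `n` is invertible modulo the order of `g`.
* Modulo `A = ⟨a₁^(p^j) a_(p^j)⟩` the power becomes `z^((1 + ε) x)` with `z` the class of
  `a₁^(p^j)`. For `u = a₁ b` the set `G_(p^j)(u, z^2)` contains the class of `a₁ b^(p-1)`, while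
  a point of `G_(p^j)(u, z^4)` would force `2` or `3` to vanish modulo `p`
  (`not_isFSZ_quotient`). The quotient is `S(p,j)` because killing `A` replaces `a_(p^j)` by
  `a₁^(-p^j)` (`projQ`, `exists_quotient_mulEquiv`).
* In the central product that identifies `a_(p^j)` with an element `t^(p^j)` of `C`, take
  `u = (b, t)` and `z = (a₁^(p^j), 1)`. A point of `G_(p^j)(u, z^n)` has `x = n`, and the factor
  `t` has to compensate the change `±n` or `0` of `ε x`; so the set is nonempty for `n = 1` and
  empty for `n = 2` (`exists_centralProduct_not_isFSZ`).
-/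

namespace FSZ

/-! ### Geometric sums of a unipotent element -/

section Ring

variable {R : Type*} [Ring R] {p j : ℕ} [Fact p.Prime]

/-- The binomial expansion of `((1 + e) ^ (p ^ j) - 1) / e`, reduced by `p e = 0`. -/
theorem geom_sum_one_add (hj : 0 < j) {e : R} (he : (p : R) * e = 0) :
    ∑ i ∈ Finset.range (p ^ j), (1 + e) ^ i = (p ^ j : ℕ) + e ^ (p ^ j - 1) := by
  have hp : p.Prime := Fact.out
  have h := congrArg (Polynomial.aeval e)
    (Polynomial.geom_sum_X_comp_X_add_one_eq_sum (R := ℤ) (p ^ j))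
  simp only [Polynomial.sum_comp, Polynomial.pow_comp, Polynomial.X_comp, map_sum, map_mul,
    map_pow, map_add, Polynomial.aeval_X, map_one, map_natCast] at h
  simp only [add_comm (1 : R) e]
  rw [h]
  obtain ⟨N, hN⟩ : ∃ N, p ^ j = N + 1 + 1 :=
    ⟨p ^ j - 2, by have := Nat.one_lt_pow hj.ne' hp.one_lt; omega⟩
  -- only the two extreme terms survive: the other binomial coefficients are divisible by `p`
  rw [hN, Finset.sum_range_succ, Finset.sum_range_succ', Finset.sum_eq_zero]
  · simp
  · intro i hi
    have hi := Finset.mem_range.1 hi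
    obtain ⟨t, ht⟩ : p ∣ (N + 1 + 1).choose (i + 1 + 1) := by
      rw [← hN]
      exact hp.dvd_choose_pow (by omega) (by omega)
    rw [ht, mul_comm p t, Nat.cast_mul, pow_succ', mul_assoc, ← mul_assoc _ e, he]
    simp

theorem one_add_pow_prime_pow (hj : 0 < j) {d : R} (hd : (p : R) * d = 0)
    (hn : d ^ p ^ j = 0) : (1 + d) ^ p ^ j = 1 := by
  have h := geom_sum_mul (1 + d) (p ^ j)
  have h0 : ((p ^ j : ℕ) : R) * d = 0 := by
    obtain ⟨i, rfl⟩ := Nat.exists_eq_succ_of_ne_zero hj.ne'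
    rw [pow_succ, Nat.cast_mul, mul_assoc, hd, mul_zero]
  rw [geom_sum_one_add hj hd, add_sub_cancel_left, add_mul, h0, ← pow_succ,
    Nat.sub_add_cancel (Nat.pos_of_ne_zero (pow_ne_zero _ (Fact.out : p.Prime).ne_zero)), hn,
    add_zero] at h
  exact (sub_eq_zero.1 h.symm)

/-- If `b = 1 + d` with `p d = 0` and `d ^ (p ^ j) = 0`, the sum of the first `p ^ j` powers of
`b ^ k` depends on `k` only through whether `p` divides it: by Fermat `k ^ (p ^ j - 1)` is `0` or
`1` modulo `p`. -/
theorem geom_sum_pow_one_add (hj : 0 < j) {d : R} (hd : (p : R) * d = 0)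
    (hn : d ^ p ^ j = 0) (k : ℕ) :
    ∑ i ∈ Finset.range (p ^ j), ((1 + d) ^ k) ^ i =
      (p ^ j : ℕ) + (k ^ (p ^ j - 1) : ℕ) * d ^ (p ^ j - 1) := by
  have hm : p ^ j - 1 + 1 = p ^ j :=
    Nat.sub_add_cancel (Nat.pos_of_ne_zero (pow_ne_zero _ (Fact.out : p.Prime).ne_zero))
  set s : R := ∑ i ∈ Finset.range k, (1 + d) ^ i with hs
  have hds : Commute d s :=
    Commute.sum_right _ _ _ fun i _ =>
      ((Commute.one_right d).add_right (Commute.refl d)).pow_right i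
  have hk : (1 + d) ^ k = 1 + d * s := by
    have := geom_sum_mul (1 + d) k
    rw [add_sub_cancel_left, ← hs, ← hds.eq] at this
    rw [this]; abel
  -- `d ^ (p ^ j - 1)` annihilates `d`, so it absorbs every power of `1 + d`
  have hdb : ∀ i : ℕ, d ^ (p ^ j - 1) * (1 + d) ^ i = d ^ (p ^ j - 1) := by
    intro i
    induction i with
    | zero => simp
    | succ i ih => rw [pow_succ, ← mul_assoc, ih, mul_add, mul_one, ← pow_succ, hm, hn, add_zero]
  have hdk : d ^ (p ^ j - 1) * s = k * d ^ (p ^ j - 1) := by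
    rw [hs, Finset.mul_sum, Finset.sum_congr rfl fun i _ => hdb i]
    simp
  have hdsp : ∀ i : ℕ, d ^ (p ^ j - 1) * s ^ i = (k ^ i : ℕ) * d ^ (p ^ j - 1) := by
    intro i
    induction i with
    | zero => simp
    | succ i ih =>
      rw [pow_succ, ← mul_assoc, ih, mul_assoc, hdk, ← mul_assoc, ← Nat.cast_mul, pow_succ]
  rw [hk, geom_sum_one_add hj (by rw [← mul_assoc, hd, zero_mul]), hds.mul_pow, hdsp]

end Ring

/-! ### The power map of `F(p,j)` -/

section Power

variable {p j n : ℕ}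

theorem red_natCast (k : ℕ) : red p j k = k := by simp [red]

theorem emb_natCast (k : ℕ) : emb p j k = (p : ZMod (p ^ (j + 1))) ^ j * k := by
  rw [← Int.cast_natCast, emb]
  refine (ZMod.lift_coe p _ (k : ℤ)).trans ?_
  simp

theorem emb_red [NeZero p] (x : ZMod (p ^ (j + 1))) : emb p j (red p j x) = (p ^ j : ℕ) • x := by
  obtain ⟨k, rfl⟩ := ZMod.natCast_zmod_surjective x
  rw [red_natCast, emb_natCast, nsmul_eq_mul]
  push_cast; rfl

theorem emb_injective [NeZero p] : Function.Injective (emb p j) := by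
  rw [injective_iff_map_eq_zero]
  intro t ht
  obtain ⟨k, rfl⟩ := ZMod.natCast_zmod_surjective t
  rw [emb_natCast, ← Nat.cast_pow, ← Nat.cast_mul, ZMod.natCast_eq_zero_iff, pow_succ] at ht
  rw [ZMod.natCast_eq_zero_iff]
  exact Nat.dvd_of_mul_dvd_mul_left (Nat.pos_of_ne_zero (pow_ne_zero _ (NeZero.ne p))) ht

/-- The vector of exponents of the last generator `a_(n+1)`. -/
def lastVec (p n : ℕ) : Fin n → ZMod p := fun i => if (i : ℕ) + 1 = n then 1 else 0

theorem end_mul_apply {M : Type*} [AddCommGroup M] (f g : AddMonoid.End M) (y : M) :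
    (f * g) y = f (g y) := rfl

theorem end_add_apply {M : Type*} [AddCommGroup M] (f g : AddMonoid.End M) (y : M) :
    (f + g) y = f y + g y := rfl

/-- The nilpotent part `b - 1` of the automorphism `b` of `Q_{p,j}`, as an element of the
endomorphism ring. -/
def bNil (p j : ℕ) : AddMonoid.End (Q p j) := (show AddMonoid.End (Q p j) from bEnd p j) - 1

theorem bNil_apply (y : Q p j) : bNil p j y = bEnd p j y - y := rfl

theorem one_add_bNil_apply (y : Q p j) : (1 + bNil p j) y = bEnd p j y :=
  add_sub_cancel y (bEnd p j y)

/-- The exponents of `a₁⁻¹, a₂, …, a_(n+1)` modulo `p`, continued by zero. On this sequence the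
endomorphism `b - 1` acts as a shift truncated at index `n`. -/
def expSeq (y : Ab p j n) : ℕ → ZMod p
  | 0 => -red p j y.1
  | k + 1 => if h : k < n then y.2 ⟨k, h⟩ else 0

theorem bNil_fst (y : Q p j) : (bNil p j y).1 = 0 := by
  simp [bNil_apply, bEnd]

theorem expSeq_bNil_zero (y : Q p j) : expSeq (bNil p j y) 0 = 0 := by
  simp [expSeq, bNil_fst]

theorem expSeq_bNil_succ (y : Q p j) (k : ℕ) (hk : k + 1 < p ^ j) :
    expSeq (bNil p j y) (k + 1) = expSeq y k := by
  have hk' : k < p ^ j - 1 := by omega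
  cases k with
  | zero => simp [expSeq, hk', bNil_apply, bEnd, shift]
  | succ k => simp [expSeq, hk', bNil_apply, bEnd, shift, Nat.lt_of_succ_lt hk']

theorem expSeq_bNil_pow_of_lt (i : ℕ) (y : Q p j) (k : ℕ) (hk : k < i) (hkj : k < p ^ j) :
    expSeq ((bNil p j ^ i) y) k = 0 := by
  induction i generalizing k with
  | zero => omega
  | succ i ih =>
    rw [pow_succ' (bNil p j), end_mul_apply]
    cases k with
    | zero => exact expSeq_bNil_zero _
    | succ k => rw [expSeq_bNil_succ _ _ hkj]; exact ih k (by omega) (by omega)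

theorem expSeq_bNil_pow_self (i : ℕ) (y : Q p j) (hi : i < p ^ j) :
    expSeq ((bNil p j ^ i) y) i = expSeq y 0 := by
  induction i with
  | zero => rfl
  | succ i ih =>
    rw [pow_succ' (bNil p j), end_mul_apply, expSeq_bNil_succ _ _ hi, ih (by omega)]

theorem bNil_pow_fst {i : ℕ} (hi : 0 < i) (y : Q p j) : ((bNil p j ^ i) y).1 = 0 := by
  obtain ⟨i, rfl⟩ := Nat.exists_eq_succ_of_ne_zero hi.ne'
  rw [pow_succ' (bNil p j), end_mul_apply, bNil_fst]

theorem snd_apply_eq_expSeq (y : Ab p j n) (i : Fin n) : y.2 i = expSeq y (i + 1) := by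
  simp [expSeq]

variable [Fact p.Prime]

theorem bNil_pow_pred (hj : 0 < j) (y : Q p j) :
    (bNil p j ^ (p ^ j - 1)) y = (0, -red p j y.1 • lastVec p (p ^ j - 1)) := by
  have h1 := Nat.one_lt_pow hj.ne' (Fact.out : p.Prime).one_lt
  refine Prod.ext (bNil_pow_fst (by omega) y) (funext fun i => ?_)
  rw [snd_apply_eq_expSeq]
  have hi := i.2
  by_cases h : (i : ℕ) + 1 = p ^ j - 1
  · rw [h, expSeq_bNil_pow_self _ _ (by omega)]
    simp [lastVec, h, expSeq]
  · rw [expSeq_bNil_pow_of_lt _ _ _ (by omega) (by omega)]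
    simp [lastVec, h]

theorem bNil_pow_eq_zero : bNil p j ^ p ^ j = 0 := by
  have h0 : 0 < p ^ j := pow_pos (Fact.out : p.Prime).pos j
  ext1 y
  refine Prod.ext (bNil_pow_fst h0 y) (funext fun i => ?_)
  rw [snd_apply_eq_expSeq, expSeq_bNil_pow_of_lt _ _ _ (by omega) (by omega)]
  rfl

theorem natCast_mul_bNil : ((p : ℕ) : AddMonoid.End (Q p j)) * bNil p j = 0 := by
  ext1 y
  rw [end_mul_apply, AddMonoid.End.natCast_apply]
  refine Prod.ext ?_ (funext fun i => ?_)
  · rw [Prod.smul_fst, bNil_fst, smul_zero]; rfl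
  · rw [Prod.smul_snd, Pi.smul_apply]
    simp

theorem b_pow_apply (k : ℕ) (q : Q p j) :
    (b p j ^ k) (Multiplicative.ofAdd q) = Multiplicative.ofAdd (((1 + bNil p j) ^ k) q) := by
  induction k with
  | zero => rfl
  | succ k ih =>
    rw [pow_succ' (b p j), MulAut.mul_apply, ih, pow_succ' (1 + bNil p j), end_mul_apply,
      one_add_bNil_apply]
    rfl

theorem b_pow_prime_pow (hj : 0 < j) : b p j ^ p ^ j = 1 := by
  ext1 q
  obtain ⟨q, rfl⟩ := Multiplicative.ofAdd.surjective q
  rw [b_pow_apply, one_add_pow_prime_pow hj natCast_mul_bNil bNil_pow_eq_zero]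
  rfl

theorem exists_right_eq_pow (f : F p j) :
    ∃ k : ℕ, (f.right : MulAut (Multiplicative (Q p j))) = b p j ^ k := by
  obtain ⟨k, hk⟩ := mem_powers_iff_mem_zpowers.2 f.right.2
  exact ⟨k, hk.symm⟩

/-- The exponent of `a₁` modulo `p`. -/
def expFst (f : F p j) : ZMod p := red p j (Multiplicative.toAdd f.left).1

theorem b_fst (k : ℕ) (q : Q p j) : (((1 + bNil p j) ^ k) q).1 = q.1 := by
  induction k with
  | zero => rfl
  | succ k ih =>
    rw [pow_succ' (1 + bNil p j), end_mul_apply, end_add_apply, Prod.fst_add, bNil_fst, add_zero]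
    exact ih

theorem expFst_mul (f g : F p j) : expFst (f * g) = expFst f + expFst g := by
  obtain ⟨k, hk⟩ := exists_right_eq_pow f
  obtain ⟨q, hq⟩ := Multiplicative.ofAdd.surjective g.left
  rw [expFst, SemidirectProduct.mul_left, Subgroup.coe_subtype, hk, ← hq, b_pow_apply, toAdd_mul,
    Prod.fst_add, map_add, toAdd_ofAdd, b_fst, expFst, expFst, ← hq, toAdd_ofAdd]

theorem left_pow {f : F p j} {k : ℕ}
    (hk : (f.right : MulAut (Multiplicative (Q p j))) = b p j ^ k) (i : ℕ) :
    (f ^ i).left = Multiplicative.ofAdd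
      ((∑ t ∈ Finset.range i, ((1 + bNil p j) ^ k) ^ t) (Multiplicative.toAdd f.left)) := by
  induction i with
  | zero => rfl
  | succ i ih =>
    obtain ⟨q, hq⟩ := Multiplicative.ofAdd.surjective f.left
    have hr : ((f ^ i).right : MulAut (Multiplicative (Q p j))) = b p j ^ (k * i) := by
      have : (f ^ i).right = f.right ^ i := map_pow SemidirectProduct.rightHom f i
      rw [this, Subgroup.coe_pow, hk, pow_mul]
    rw [pow_succ f, SemidirectProduct.mul_left, ih, Subgroup.coe_subtype, hr, ← hq, b_pow_apply,
      Finset.sum_range_succ, ← ofAdd_add, toAdd_ofAdd, pow_mul]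
    rfl

/-- The `p ^ j`-th power of `a₁^x ⋯ b^k` is `a₁^(x p^j)` if `p ∣ k`, and
`a₁^(x p^j) a_(p^j)^(-x)` otherwise. -/
theorem pow_prime_pow_eq (hj : 0 < j) {f : F p j} {k : ℕ}
    (hk : (f.right : MulAut (Multiplicative (Q p j))) = b p j ^ k) :
    f ^ p ^ j = SemidirectProduct.inl (Multiplicative.ofAdd
      (emb p j (expFst f), -(if p ∣ k then 0 else expFst f) • lastVec p (p ^ j - 1))) := by
  have hp : p.Prime := Fact.out
  refine SemidirectProduct.ext ?_ ?_
  · rw [left_pow hk, geom_sum_pow_one_add hj natCast_mul_bNil bNil_pow_eq_zero,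
      SemidirectProduct.left_inl, end_add_apply, end_mul_apply, bNil_pow_pred hj,
      AddMonoid.End.natCast_apply, AddMonoid.End.natCast_apply]
    congr 1
    refine Prod.ext ?_ ?_
    · simp [expFst, emb_red]
    · have h0 : (p ^ j : ℕ) • (Multiplicative.toAdd f.left).2 = 0 := by
        ext i; simp [hj.ne']
      have hF : ((k : ZMod p)) ^ (p ^ j - 1) = if p ∣ k then 0 else 1 := by
        split_ifs with h
        · rw [(ZMod.natCast_eq_zero_iff k p).2 h, zero_pow]
          have := Nat.one_lt_pow hj.ne' hp.one_lt
          omega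
        · have h' : (k : ZMod p) ≠ 0 := fun h2 => h ((ZMod.natCast_eq_zero_iff k p).1 h2)
          obtain ⟨t, ht⟩ := Nat.sub_one_dvd_pow_sub_one p j
          rw [ht, pow_mul, ZMod.pow_card_sub_one_eq_one h', one_pow]
      rw [Prod.snd_add, Prod.smul_snd, h0, zero_add, Prod.smul_snd]
      funext i
      simp only [Pi.smul_apply, nsmul_eq_mul, smul_eq_mul]
      push_cast
      rw [hF]
      split_ifs <;> simp [expFst]
  · have : (f ^ p ^ j).right = f.right ^ p ^ j := map_pow SemidirectProduct.rightHom f _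
    rw [this, SemidirectProduct.right_inl]
    refine Subtype.ext ?_
    rw [Subgroup.coe_pow, hk, ← pow_mul, mul_comm, pow_mul, b_pow_prime_pow hj, one_pow]
    rfl

end Power

/-! ### Central elements and the property `FSZ` for `F(p,j)` -/

section Center

variable {p j : ℕ} [Fact p.Prime]

/-- The central element `a₁^(t p^j) a_(p^j)^s` of `F(p,j)`; both exponents matter only
modulo `p`. -/
noncomputable def cent (p j : ℕ) [Fact p.Prime] (t s : ZMod p) : F p j :=
  SemidirectProduct.inl (Multiplicative.ofAdd (emb p j t, s • lastVec p (p ^ j - 1)))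

theorem cent_mul (t s t' s' : ZMod p) :
    cent p j t s * cent p j t' s' = cent p j (t + t') (s + s') := by
  rw [cent, cent, cent, ← map_mul, ← ofAdd_add, Prod.mk_add_mk, ← map_add, ← add_smul]

theorem cent_zero : cent p j 0 0 = 1 := by
  rw [cent, map_zero, zero_smul]
  exact map_one _

theorem cent_inv (t s : ZMod p) : (cent p j t s)⁻¹ = cent p j (-t) (-s) := by
  rw [inv_eq_iff_mul_eq_one, cent_mul, add_neg_cancel, add_neg_cancel, cent_zero]

theorem cent_pow (t s : ZMod p) (n : ℕ) : cent p j t s ^ n = cent p j (n * t) (n * s) := by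
  induction n with
  | zero => simp [cent_zero]
  | succ n ih => rw [pow_succ, ih, cent_mul]; push_cast; ring_nf

theorem cent_inj (hj : 0 < j) {t s t' s' : ZMod p} (h : cent p j t s = cent p j t' s') :
    t = t' ∧ s = s' := by
  have h1 := Nat.one_lt_pow hj.ne' (Fact.out : p.Prime).one_lt
  have h2 := Multiplicative.ofAdd.injective (SemidirectProduct.inl_injective h)
  refine ⟨emb_injective (congrArg Prod.fst h2), ?_⟩
  have h3 := congrFun (congrArg Prod.snd h2) ⟨p ^ j - 1 - 1, by omega⟩
  simpa [lastVec, show p ^ j - 1 - 1 + 1 = p ^ j - 1 by omega] using h3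

theorem bEnd_emb_lastVec (hj : 0 < j) (t s : ZMod p) :
    bEnd p j (emb p j t, s • lastVec p (p ^ j - 1)) = (emb p j t, s • lastVec p (p ^ j - 1)) := by
  refine Prod.ext rfl (funext fun ⟨i, hi⟩ => ?_)
  cases i with
  | zero => simp [bEnd, shift, red_emb p j hj]
  | succ k => simp [bEnd, shift, lastVec, hi.ne]

theorem cent_mem_center (hj : 0 < j) (t s : ZMod p) : cent p j t s ∈ Subgroup.center (F p j) := by
  rw [Subgroup.mem_center_iff]
  intro f
  refine SemidirectProduct.ext ?_ ?_
  · obtain ⟨k, hk⟩ := exists_right_eq_pow f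
    have hfix : ∀ k : ℕ, (b p j ^ k) (Multiplicative.ofAdd (emb p j t, s • lastVec p (p ^ j - 1))) =
        Multiplicative.ofAdd (emb p j t, s • lastVec p (p ^ j - 1)) := by
      intro k
      induction k with
      | zero => rfl
      | succ k ih =>
        rw [pow_succ' (b p j), MulAut.mul_apply, ih]
        exact congrArg Multiplicative.ofAdd (bEnd_emb_lastVec hj t s)
    rw [SemidirectProduct.mul_left, SemidirectProduct.mul_left, Subgroup.coe_subtype, hk, cent,
      SemidirectProduct.left_inl, hfix, mul_comm]
    simp
  · simp [cent]

/-- `pow_prime_pow_eq` in terms of `cent`. -/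
theorem pow_prime_pow_eq_cent (hj : 0 < j) {f : F p j} {k : ℕ}
    (hk : (f.right : MulAut (Multiplicative (Q p j))) = b p j ^ k) :
    f ^ p ^ j = cent p j (expFst f) (-(if p ∣ k then 0 else expFst f)) :=
  pow_prime_pow_eq hj hk

theorem expFst_eq_of_pow_eq (hj : 0 < j) {f f' : F p j} (h : f ^ p ^ j = f' ^ p ^ j) :
    expFst f = expFst f' := by
  obtain ⟨k, hk⟩ := exists_right_eq_pow f
  obtain ⟨k', hk'⟩ := exists_right_eq_pow f'
  rw [pow_prime_pow_eq_cent hj hk, pow_prime_pow_eq_cent hj hk'] at h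
  exact (cent_inj hj h).1

theorem pow_prime_pow_eq_pow (hj : 0 < j) {f f' : F p j} (hr : f'.right = f.right) {n : ℕ}
    (h : expFst f' = n * expFst f) : f' ^ p ^ j = (f ^ p ^ j) ^ n := by
  obtain ⟨k, hk⟩ := exists_right_eq_pow f
  rw [pow_prime_pow_eq_cent hj hk, pow_prime_pow_eq_cent hj (hr ▸ hk), cent_pow, h]
  split_ifs <;> simp

/-- The element `a₁^t b^k` of `F(p,j)`. -/
noncomputable def elt (p j : ℕ) [Fact p.Prime] (t k : ℕ) : F p j :=
  ⟨Multiplicative.ofAdd (t, 0), ⟨b p j ^ k, Subgroup.npow_mem_zpowers _ _⟩⟩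

theorem expFst_elt (t k : ℕ) : expFst (elt p j t k) = t := red_natCast t

theorem elt_right (t k : ℕ) :
    ((elt p j t k).right : MulAut (Multiplicative (Q p j))) = b p j ^ k := rfl

theorem mul_right_eq {f f' : F p j} {k k' : ℕ}
    (hk : (f.right : MulAut (Multiplicative (Q p j))) = b p j ^ k)
    (hk' : (f'.right : MulAut (Multiplicative (Q p j))) = b p j ^ k') :
    ((f * f').right : MulAut (Multiplicative (Q p j))) = b p j ^ (k + k') := by
  rw [SemidirectProduct.mul_right, Subgroup.coe_mul, hk, hk', pow_add (b p j)]

instance : Finite (F p j) := Finite.of_equiv _ SemidirectProduct.equivProd.symm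

/-- Raising `g` to a power does not shrink `G_(p^j)(u, g)`: all its elements have the same exponent
`x` of `a₁` modulo `p`, and left multiplication by `a₁^((n-1)x)` maps it into
`G_(p^j)(u, g ^ n)`. -/
theorem ncard_powSet_le (hj : 0 < j) (u g : F p j) (n : ℕ) :
    (powSet (p ^ j) u g).ncard ≤ (powSet (p ^ j) u (g ^ n)).ncard := by
  rcases (powSet (p ^ j) u g).eq_empty_or_nonempty with h | ⟨y, hy, -⟩
  · simp [h]
  set t : ℕ := (((n : ZMod p) - 1) * expFst y).val with ht
  have hz : ∀ a : F p j, a ^ p ^ j = g → (elt p j t 0 * a) ^ p ^ j = g ^ n := by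
    intro a ha
    rw [← ha]
    refine pow_prime_pow_eq_pow hj ?_ ?_
    · refine Subtype.ext ?_
      rw [SemidirectProduct.mul_right, Subgroup.coe_mul, elt_right, pow_zero, one_mul]
    · rw [expFst_mul, expFst_elt, ht, ZMod.natCast_zmod_val,
        expFst_eq_of_pow_eq hj (ha.trans hy.symm)]
      ring
  refine Set.ncard_le_ncard_of_injOn (elt p j t 0 * ·) (fun a ha => ⟨hz a ha.1, ?_⟩)
    (fun _ _ _ _ h => mul_left_cancel h) (Set.toFinite _)
  rw [mul_assoc]
  exact hz _ ha.2

theorem isFSZ_F (hj : 0 < j) : IsFSZ (p ^ j) (F p j) := by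
  intro n _ hcop u g
  refine le_antisymm (ncard_powSet_le hj u g n) ?_
  obtain ⟨m, hm⟩ := exists_pow_eq_self_of_coprime (x := g)
    (hcop.coprime_dvd_right (orderOf_dvd_natCard g))
  simpa only [hm] using ncard_powSet_le hj u (g ^ n) m

theorem card_F_eq_pow (hj : 0 < j) : ∃ r, Nat.card (F p j) = p ^ r := by
  obtain ⟨s, -, hs⟩ := (Nat.dvd_prime_pow Fact.out).1
    (orderOf_dvd_of_pow_eq_one (b_pow_prime_pow (p := p) hj))
  refine ⟨(j + 1) + (p ^ j - 1) + s, ?_⟩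
  rw [SemidirectProduct.card, Nat.card_zpowers, hs, Nat.card_congr Multiplicative.toAdd,
    Nat.card_prod, Nat.card_zmod, Nat.card_fun, Nat.card_zmod, Nat.card_fin, pow_add p (_ + _) s,
    pow_add p (j + 1)]

/-- For `p` odd the exponent `n = 2` is coprime to the order of a `p`-group, so it may be used to
refute `FSZ`. -/
theorem not_isFSZ_of_sq {G : Type*} [Group G] [Finite G] {m r : ℕ} (hp : 2 < p)
    (hG : Nat.card G ∣ p ^ r) {u g : G} (h1 : (powSet m u g).Nonempty)
    (h2 : powSet m u (g ^ 2) = ∅) : ¬ IsFSZ m G := by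
  intro h
  have h2p : Nat.Coprime 2 p := (Nat.coprime_primes Nat.prime_two Fact.out).2 hp.ne
  have := h 2 two_pos ((h2p.pow_right r).coprime_dvd_right hG) u g
  rw [h2, Set.ncard_empty, Set.ncard_eq_zero] at this
  exact h1.ne_empty this

theorem natCast_zmod_ne_zero {p k : ℕ} (hk : 0 < k) (hkp : k < p) : (k : ZMod p) ≠ 0 := fun h =>
  absurd (Nat.le_of_dvd hk ((ZMod.natCast_eq_zero_iff k p).1 h)) (not_le.2 hkp)

theorem mem_zpowers_cent {t s : ZMod p} {x : F p j} :
    x ∈ Subgroup.zpowers (cent p j t s) ↔ ∃ i : ZMod p, x = cent p j (i * t) (i * s) := by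
  rw [← mem_powers_iff_mem_zpowers]
  constructor
  · rintro ⟨n, rfl⟩
    exact ⟨n, cent_pow t s n⟩
  · rintro ⟨i, rfl⟩
    exact ⟨i.val, by simp only [cent_pow, ZMod.natCast_zmod_val]⟩

theorem card_zpowers_cent (hj : 0 < j) {t s : ZMod p} (hs : s ≠ 0) :
    Nat.card (Subgroup.zpowers (cent p j t s)) = p := by
  rw [Nat.card_zpowers]
  refine orderOf_eq_prime ?_ fun h => hs ?_
  · rw [cent_pow]; simp [cent_zero]
  · rw [← cent_zero] at h
    exact (cent_inj hj h).2

theorem zpowers_cent_le_center (hj : 0 < j) (t s : ZMod p) :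
    Subgroup.zpowers (cent p j t s) ≤ Subgroup.center (F p j) :=
  Subgroup.zpowers_le.2 (cent_mem_center hj t s)

end Center

/-! ### The quotient by `⟨a₁^(p^j) a_(p^j)⟩` -/

section Quotient

variable {p j : ℕ} [Fact p.Prime]

theorem not_isFSZ_quotient (hj : 0 < j) (hp : 3 < p) [(Subgroup.zpowers (cent p j 1 1)).Normal] :
    ¬ IsFSZ (p ^ j) (F p j ⧸ Subgroup.zpowers (cent p j 1 1)) := by
  obtain ⟨r, hr⟩ := card_F_eq_pow (p := p) hj
  have h2 : (2 : ZMod p) ≠ 0 := natCast_zmod_ne_zero (k := 2) two_pos (by omega)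
  have h3 : (3 : ZMod p) ≠ 0 := natCast_zmod_ne_zero (k := 3) three_pos hp
  have hp1 : p ≠ 1 := by omega
  -- in the quotient `a_(p^j)` equals `a₁^(-p^j)`, so only `t - s` matters for `cent t s`
  have hmk : ∀ t s t' s' : ZMod p,
      ((cent p j t s : F p j) : F p j ⧸ Subgroup.zpowers (cent p j 1 1)) = cent p j t' s' ↔
        t' - t = s' - s := by
    intro t s t' s'
    rw [QuotientGroup.eq, cent_inv, cent_mul, mem_zpowers_cent]
    constructor
    · rintro ⟨i, hi⟩
      have := cent_inj hj hi
      linear_combination this.1 - this.2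
    · intro h
      refine ⟨t' - t, ?_⟩
      congr 1
      · ring
      · linear_combination -h
  refine not_isFSZ_of_sq (r := r) (u := (elt p j 1 1 : F p j)) (g := (cent p j 2 0 : F p j))
    (by omega) (hr ▸ Subgroup.card_quotient_dvd_card _) ?_ ?_
  · refine ⟨(elt p j 1 (p - 1) : F p j), ?_, ?_⟩
    · have hd : ¬ p ∣ p - 1 := fun h => absurd (Nat.le_of_dvd (by omega) h) (by omega)
      rw [← QuotientGroup.mk_pow, pow_prime_pow_eq_cent hj (elt_right 1 (p - 1)), hmk, expFst_elt,
        if_neg hd]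
      push_cast; ring
    · rw [← QuotientGroup.mk_mul, ← QuotientGroup.mk_pow, pow_prime_pow_eq_cent hj
        (mul_right_eq (elt_right 1 (p - 1)) (elt_right 1 1)), hmk, expFst_mul, expFst_elt,
        expFst_elt, Nat.sub_add_cancel (by omega), if_pos dvd_rfl]
      push_cast; ring
  · rw [Set.eq_empty_iff_forall_notMem]
    intro x
    obtain ⟨f, rfl⟩ := QuotientGroup.mk_surjective x
    rintro ⟨hx1, hx2⟩
    obtain ⟨k, hk⟩ := exists_right_eq_pow f
    rw [← QuotientGroup.mk_pow, ← QuotientGroup.mk_pow, cent_pow, pow_prime_pow_eq_cent hj hk,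
      hmk] at hx1
    rw [← QuotientGroup.mk_mul, ← QuotientGroup.mk_pow, ← QuotientGroup.mk_pow, cent_pow,
      pow_prime_pow_eq_cent hj (mul_right_eq hk (elt_right 1 1)), hmk, expFst_mul,
      expFst_elt] at hx2
    push_cast at hx1 hx2
    -- with `x = expFst f`, the three cases give `x = 4` and `2 (x + 1) = 4`; `2 x = 4` and
    -- `x + 1 = 4`; `2 x = 4` and `2 (x + 1) = 4`
    by_cases hk0 : p ∣ k
    · have hk1 : ¬ p ∣ k + 1 := fun h => hp1 (Nat.dvd_one.1 ((Nat.dvd_add_right hk0).1 h))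
      rw [if_pos hk0] at hx1
      rw [if_neg hk1] at hx2
      exact mul_ne_zero h2 h3 (by linear_combination 2 * hx1 - hx2)
    · rw [if_neg hk0] at hx1
      split_ifs at hx2
      · exact mul_ne_zero h2 (one_ne_zero) (by linear_combination 2 * hx2 - hx1)
      · exact h2 (by linear_combination hx1 - hx2)

end Quotient

/-! ### Central products with a cyclic group -/

section CentralProduct

variable {p j : ℕ} [Fact p.Prime]

/-- The amalgamated subgroups are `⟨a_(p^j)⟩` and the subgroup of order `p` of `C`. -/
theorem exists_centralProduct_not_isFSZ (hj : 0 < j) (hp : 3 < p) (C : Type*) [Group C]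
    [IsCyclic C] (hC : Nat.card C = p ^ (j + 1)) :
    ∃ (A : Subgroup (F p j)) (B : Subgroup C)
      (hA : A ≤ Subgroup.center (F p j)) (hB : B ≤ Subgroup.center C) (φ : A ≃* B),
      ¬ IsFSZ (p ^ j) (CentralProduct hA hB φ) := by
  have hp0 : p.Prime := Fact.out
  obtain ⟨c₀, hc₀⟩ := IsCyclic.exists_generator (α := C)
  have hfin : Finite C := Nat.finite_of_card_ne_zero (by rw [hC]; exact pow_ne_zero _ hp0.ne_zero)
  have hordc : orderOf c₀ = p ^ (j + 1) := by rw [orderOf_eq_card_of_forall_mem_zpowers hc₀, hC]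
  have hB0 : Nat.card (Subgroup.zpowers (c₀ ^ p ^ j)) = p := by
    rw [Nat.card_zpowers, orderOf_pow_of_dvd (pow_ne_zero _ hp0.ne_zero)
      (hordc ▸ pow_dvd_pow p (Nat.le_succ j)), hordc, pow_succ,
      Nat.mul_div_cancel_left _ (pow_pos hp0.pos j)]
  have hA0 : Nat.card (Subgroup.zpowers (cent p j 0 1)) = p := card_zpowers_cent hj one_ne_zero
  have hA := zpowers_cent_le_center (p := p) hj 0 1
  have hcomm : ∀ x y : C, x * y = y * x := (IsCyclic.commGroup (α := C)).mul_comm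
  have hB : Subgroup.zpowers (c₀ ^ p ^ j) ≤ Subgroup.center C :=
    fun x _ => Subgroup.mem_center_iff.2 fun y => hcomm y x
  obtain ⟨φ⟩ : Nonempty (Subgroup.zpowers (cent p j 0 1) ≃* Subgroup.zpowers (c₀ ^ p ^ j)) :=
    ⟨mulEquivOfPrimeCardEq hA0 hB0⟩
  refine ⟨_, _, hA, hB, φ, ?_⟩
  obtain ⟨r, hr⟩ := card_F_eq_pow (p := p) hj
  have h3 : (3 : ZMod p) ≠ 0 := natCast_zmod_ne_zero (k := 3) three_pos hp
  have hp1 : p ≠ 1 := by omega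
  have hmem : ∀ i : ZMod p, cent p j 0 i ∈ Subgroup.zpowers (cent p j 0 1) := fun i =>
    mem_zpowers_cent.2 ⟨i, by simp⟩
  -- `ψ i` is the element of `C` that gets identified with `a_(p^j)^i`
  set ψ : ZMod p → C := fun i => (φ ⟨cent p j 0 i, hmem i⟩ : C) with hψ
  have hψadd : ∀ i i', ψ (i + i') = ψ i * ψ i' := by
    intro i i'
    simp only [hψ, ← Subgroup.coe_mul, ← map_mul]
    congr 2
    exact Subtype.ext (by simp [cent_mul])
  have hψ0 : ψ 0 = 1 := by
    have h := hψadd 0 0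
    rwa [add_zero, left_eq_mul] at h
  have hψinj : Function.Injective ψ := fun i i' h =>
    (cent_inj hj (congrArg Subtype.val (φ.injective (Subtype.ext h)))).2
  have hker : ∀ t s (x : C), (cent p j t s, x) ∈ centralKernel hA hB φ ↔ t = 0 ∧ x = ψ (-s) := by
    intro t s x
    constructor
    · rintro ⟨⟨a, ha⟩, h⟩
      obtain ⟨i, rfl⟩ := mem_zpowers_cent.1 ha
      have ha1 := cent_inj hj (congrArg Prod.fst h)
      have ha2 : x = _ := congrArg Prod.snd h
      refine ⟨by simpa using ha1.1, ha2.trans ?_⟩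
      simp only [hψ]
      congr 2
      refine Subtype.ext ?_
      simp [cent_inv, ha1.2]
    · rintro ⟨rfl, rfl⟩
      refine ⟨⟨cent p j 0 s, hmem s⟩, Prod.ext rfl ?_⟩
      simp only [hψ]
      congr 2
      refine Subtype.ext ?_
      simp [cent_inv]
  have hmk : ∀ t s t' s' (x x' : C),
      ((cent p j t s, x) : CentralProduct hA hB φ) = ((cent p j t' s', x') : F p j × C) ↔
        t = t' ∧ x⁻¹ * x' = ψ (s - s') := by
    intro t s t' s' x x'
    rw [QuotientGroup.eq, Prod.inv_mk, Prod.mk_mul_mk, cent_inv, cent_mul, hker, neg_add_eq_zero,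
      neg_add, neg_neg, sub_eq_add_neg]
  -- `t = c₀ ^ e` is a `p ^ j`-th root of the element identified with `a_(p^j)`
  obtain ⟨e, he⟩ := mem_powers_iff_mem_zpowers.2 (φ ⟨cent p j 0 1, hmem 1⟩).2
  have ht : (c₀ ^ e) ^ p ^ j = ψ 1 := by
    rw [← pow_mul, mul_comm, pow_mul]; exact he
  refine not_isFSZ_of_sq (p := p) (r := r + (j + 1)) (u := ((elt p j 0 1, c₀ ^ e) : F p j × C))
    (g := ((cent p j 1 0, 1) : F p j × C)) (by omega) ?_ ?_ ?_
  · have h : Nat.card (F p j × C) = p ^ (r + (j + 1)) := by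
      rw [Nat.card_prod, hr, hC, pow_add p r]
    exact h ▸ Subgroup.card_quotient_dvd_card (centralKernel hA hB φ)
  · refine ⟨((elt p j 1 0, 1) : F p j × C), ?_, ?_⟩
    · rw [← QuotientGroup.mk_pow, Prod.pow_mk, pow_prime_pow_eq_cent hj (elt_right 1 0), hmk,
        expFst_elt, if_pos (dvd_zero p)]
      simp [hψ0]
    · rw [← QuotientGroup.mk_mul, ← QuotientGroup.mk_pow, Prod.mk_mul_mk, Prod.pow_mk,
        pow_prime_pow_eq_cent hj (mul_right_eq (elt_right 1 0) (elt_right 0 1)), hmk, expFst_mul,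
        expFst_elt, expFst_elt, if_neg (by simpa using hp1), one_mul, ht]
      refine ⟨by simp, ?_⟩
      rw [mul_one, inv_eq_iff_mul_eq_one, ← hψadd, ← hψ0]
      congr 1
      simp
  · rw [Set.eq_empty_iff_forall_notMem]
    intro x
    obtain ⟨⟨f, s⟩, rfl⟩ := QuotientGroup.mk_surjective x
    rintro ⟨hx1, hx2⟩
    obtain ⟨k, hk⟩ := exists_right_eq_pow f
    rw [← QuotientGroup.mk_pow, ← QuotientGroup.mk_pow, Prod.pow_mk, Prod.pow_mk, cent_pow,
      pow_prime_pow_eq_cent hj hk, hmk] at hx1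
    rw [← QuotientGroup.mk_mul, ← QuotientGroup.mk_pow, ← QuotientGroup.mk_pow, Prod.mk_mul_mk,
      Prod.pow_mk, Prod.pow_mk, cent_pow,
      pow_prime_pow_eq_cent hj (mul_right_eq hk (elt_right 0 1)), hmk, expFst_mul, expFst_elt,
      (show Commute s (c₀ ^ e) from hcomm _ _).mul_pow, ht] at hx2
    obtain ⟨hf, hx1⟩ := hx1
    obtain ⟨-, hx2⟩ := hx2
    rw [one_pow, mul_one, mul_zero, sub_zero] at hx1 hx2
    rw [mul_inv_rev, hx1, inv_mul_eq_iff_eq_mul, ← hψadd] at hx2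
    -- `key` compares `ε x` before and after multiplication by `u`: they differ by exactly `1`
    have key := hψinj hx2
    rw [hf, Nat.cast_zero, add_zero] at key
    push_cast at key
    by_cases hk0 : p ∣ k
    · have hk1 : ¬ p ∣ k + 1 := fun h => hp1 (Nat.dvd_one.1 ((Nat.dvd_add_right hk0).1 h))
      rw [if_pos hk0, if_neg hk1] at key
      exact one_ne_zero (α := ZMod p) (by linear_combination key)
    · rw [if_neg hk0] at key
      split_ifs at key
      · exact h3 (by linear_combination -key)
      · exact one_ne_zero (α := ZMod p) (by linear_combination -key)

end CentralProduct

/-! ### The isomorphism with `S(p,j)` -/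

section Iso

variable {p j : ℕ}

/-- The map `Q_{p,j} → P_{p,j}` that sends `a_(p^j)` to `a₁^(-p^j)` and fixes the other
generators. -/
def projQ (p j : ℕ) : Q p j →+ P p j where
  toFun y := (y.1 - emb p j (last p j _ y), fun i => y.2 ⟨i, by have := i.2; omega⟩)
  map_zero' := by ext <;> simp
  map_add' x y := by
    ext
    · simp [add_sub_add_comm]
    · simp

theorem projQ_fst (y : Q p j) : (projQ p j y).1 = y.1 - emb p j (last p j _ y) := rfl

theorem projQ_snd (y : Q p j) (i : Fin (p ^ j - 2)) :
    (projQ p j y).2 i = y.2 ⟨i, by have := i.2; omega⟩ := rfl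

theorem last_eq {n : ℕ} (h : 0 < n) (y : Ab p j n) : last p j n y = y.2 ⟨n - 1, by omega⟩ := by
  simp [last, h]

variable [Fact p.Prime]

theorem projQ_bEnd (hj : 0 < j) (hp : 3 ≤ p) (y : Q p j) :
    projQ p j (bEnd p j y) = cEnd p j (projQ p j y) := by
  have h3 : 3 ≤ p ^ j := hp.trans (Nat.le_self_pow hj.ne' p)
  refine Prod.ext ?_ (funext fun ⟨i, hi⟩ => ?_)
  · have hl : last p j _ (bEnd p j y) = last p j _ y + last p j _ (projQ p j y) := by
      rw [last_eq (by omega), last_eq (by omega), last_eq (by omega), projQ_snd]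
      obtain ⟨N, hN⟩ : ∃ N, p ^ j - 1 - 1 = N + 1 := ⟨p ^ j - 3, by omega⟩
      have hN' : p ^ j - 2 - 1 = N := by omega
      simp only [hN, hN']
      rfl
    rw [projQ_fst, hl, map_add]
    change _ = (projQ p j y).1 - emb p j (last p j _ (projQ p j y))
    rw [projQ_fst, sub_sub]
    rfl
  · rw [projQ_snd]
    cases i with
    | zero => simp [bEnd, cEnd, shift, projQ_fst, projQ_snd, red_emb p j hj]
    | succ k => simp [bEnd, cEnd, shift, projQ_snd]

theorem projQ_surjective (hj : 0 < j) (hp : 3 ≤ p) : Function.Surjective (projQ p j) := by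
  have h3 : 3 ≤ p ^ j := hp.trans (Nat.le_self_pow hj.ne' p)
  intro z
  refine ⟨(z.1, fun i => if h : (i : ℕ) < p ^ j - 2 then z.2 ⟨i, h⟩ else 0), ?_⟩
  refine Prod.ext ?_ (funext fun i => ?_)
  · rw [projQ_fst, last_eq (by omega)]
    simp [show ¬ (p ^ j - 1 - 1 < p ^ j - 2) by omega]
  · rw [projQ_snd]
    simp

theorem projQ_eq_zero (hj : 0 < j) (hp : 3 ≤ p) {y : Q p j} :
    projQ p j y = 0 ↔ ∃ i : ZMod p, y = (emb p j i, i • lastVec p (p ^ j - 1)) := by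
  have h3 : 3 ≤ p ^ j := hp.trans (Nat.le_self_pow hj.ne' p)
  constructor
  · intro h
    refine ⟨last p j _ y, Prod.ext (sub_eq_zero.1 (congrArg Prod.fst h)) (funext fun ⟨i, hi⟩ => ?_)⟩
    by_cases hl : i + 1 = p ^ j - 1
    · have : i = p ^ j - 1 - 1 := by omega
      subst this
      rw [last_eq (by omega)]
      simp [lastVec, hl]
    · have := congrFun (congrArg Prod.snd h) ⟨i, by omega⟩
      rw [projQ_snd] at this
      simpa [lastVec, hl] using this
  · rintro ⟨i, rfl⟩
    refine Prod.ext ?_ (funext fun k => ?_)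
    · rw [projQ_fst, last_eq (by omega)]
      simp [lastVec, show p ^ j - 1 - 1 + 1 = p ^ j - 1 by omega]
    · have := k.2
      rw [projQ_snd]
      simp [lastVec, show (k : ℕ) + 1 ≠ p ^ j - 1 by omega]

theorem projQ_b_pow (hj : 0 < j) (hp : 3 ≤ p) (k : ℕ) (q : Multiplicative (Q p j)) :
    (projQ p j).toMultiplicative ((b p j ^ k) q) =
      (c p j ^ k) ((projQ p j).toMultiplicative q) := by
  induction k with
  | zero => rfl
  | succ k ih =>
    rw [pow_succ' (b p j), pow_succ' (c p j), MulAut.mul_apply, MulAut.mul_apply, ← ih]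
    exact congrArg Multiplicative.ofAdd (projQ_bEnd hj hp _)

/-- `b` and `c` have the same order: `c` is induced by `b` on a quotient of `Q_{p,j}`, and if
`b ^ k` acts trivially there, then `b ^ k q - q` lies in the kernel and has trivial `a₁`-component,
so that it vanishes. -/
theorem orderOf_b_eq_orderOf_c (hj : 0 < j) (hp : 3 ≤ p) : orderOf (b p j) = orderOf (c p j) := by
  rw [orderOf_eq_orderOf_iff]
  intro k
  constructor
  · intro h
    ext1 z
    obtain ⟨y, hy⟩ := projQ_surjective hj hp (Multiplicative.toAdd z)
    have := projQ_b_pow hj hp k (Multiplicative.ofAdd y)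
    rw [h] at this
    change Multiplicative.ofAdd (projQ p j y) =
      (c p j ^ k) (Multiplicative.ofAdd (projQ p j y)) at this
    rw [hy] at this
    exact this.symm
  · intro h
    ext1 q
    obtain ⟨q, rfl⟩ := Multiplicative.ofAdd.surjective q
    have h1 := projQ_b_pow hj hp k (Multiplicative.ofAdd q)
    rw [h, b_pow_apply] at h1
    have h2 : projQ p j (((1 + bNil p j) ^ k) q - q) = 0 := by
      rw [map_sub, sub_eq_zero]
      exact Multiplicative.ofAdd.injective h1
    obtain ⟨i, hi⟩ := (projQ_eq_zero hj hp).1 h2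
    have hi1 : i = 0 := by
      refine emb_injective (p := p) (j := j) ?_
      refine (congrArg Prod.fst hi).symm.trans ?_
      rw [Prod.fst_sub, b_fst, sub_self, map_zero]
    rw [b_pow_apply, sub_eq_zero.1 (hi.trans (by simp [hi1]))]
    rfl

/-- The map `F(p,j) → S(p,j)` induced by `projQ` and `b ↦ c` is onto, with kernel generated by
`a₁^(p^j) a_(p^j)`. -/
theorem exists_quotient_mulEquiv (hj : 0 < j) (hp : 3 ≤ p)
    [(Subgroup.zpowers (cent p j 1 1)).Normal] :
    Nonempty ((F p j ⧸ Subgroup.zpowers (cent p j 1 1)) ≃* S p j) := by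
  let gb : Subgroup.zpowers (b p j) := ⟨b p j, Subgroup.mem_zpowers _⟩
  let gc : Subgroup.zpowers (c p j) := ⟨c p j, Subgroup.mem_zpowers _⟩
  have hgb : ∀ x, x ∈ Subgroup.zpowers gb := by
    rintro ⟨_, n, rfl⟩
    exact ⟨n, rfl⟩
  have hgc : ∀ x, x ∈ Subgroup.zpowers gc := by
    rintro ⟨_, n, rfl⟩
    exact ⟨n, rfl⟩
  have hord : orderOf gb = orderOf gc := by
    rw [Subgroup.orderOf_mk, Subgroup.orderOf_mk, orderOf_b_eq_orderOf_c hj hp]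
  let e : Subgroup.zpowers (b p j) ≃* Subgroup.zpowers (c p j) := mulEquivOfOrderOfEq hgb hgc hord
  have he : ∀ k : ℕ, e (gb ^ k) = gc ^ k := fun k => by
    rw [map_pow]; congr 1; exact mulEquivOfOrderOfEq_apply_gen hgb hgc hord
  let f : F p j →* S p j := SemidirectProduct.map (projQ p j).toMultiplicative e.toMonoidHom (by
    intro g
    obtain ⟨k, rfl⟩ := mem_powers_iff_mem_zpowers.2 (hgb g)
    refine MonoidHom.ext fun q => ?_
    refine (projQ_b_pow hj hp k q).trans ?_
    change _ = ((e (gb ^ k) : Subgroup.zpowers (c p j)) : MulAut (Multiplicative (P p j))) _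
    rw [he]
    rfl)
  have hf : Function.Surjective f := by
    intro y
    obtain ⟨q, hq⟩ := projQ_surjective hj hp (Multiplicative.toAdd y.left)
    refine ⟨⟨Multiplicative.ofAdd q, e.symm y.right⟩, SemidirectProduct.ext ?_ ?_⟩
    · exact congrArg Multiplicative.ofAdd hq
    · exact e.apply_symm_apply _
  have hker : Subgroup.zpowers (cent p j 1 1) = f.ker := by
    ext x
    rw [mem_zpowers_cent, MonoidHom.mem_ker]
    simp only [mul_one]
    constructor
    · rintro ⟨i, rfl⟩
      refine SemidirectProduct.ext ?_ (map_one e)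
      exact congrArg Multiplicative.ofAdd ((projQ_eq_zero hj hp).2 ⟨i, rfl⟩)
    · intro h
      obtain ⟨i, hi⟩ := (projQ_eq_zero (y := Multiplicative.toAdd x.left) hj hp).1
        (congrArg (fun z : S p j => Multiplicative.toAdd z.left) h)
      refine ⟨i, SemidirectProduct.ext (congrArg Multiplicative.ofAdd hi) ?_⟩
      exact e.injective ((congrArg SemidirectProduct.right h).trans (map_one e).symm)
  exact ⟨(QuotientGroup.quotientMulEquivOfEq hker).trans
    (QuotientGroup.quotientKerEquivOfSurjective f hf)⟩

end Iso

end FSZ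

theorem mainTheorem3 (p j : ℕ) [Fact p.Prime] (hj : 0 < j) :
    FSZ.IsFSZ (p ^ j) (FSZ.F p j) ∧
    (3 < p →
      ∃ (A : Subgroup (FSZ.F p j)) (_ : A.Normal),
        A ≤ Subgroup.center (FSZ.F p j) ∧
        Nonempty (A ≃* Multiplicative (ZMod p)) ∧
        Nonempty ((FSZ.F p j ⧸ A) ≃* FSZ.S p j) ∧
        ¬ FSZ.IsFSZ (p ^ j) (FSZ.F p j ⧸ A)) ∧
    (3 < p →
      ∀ (C : Type*) [Group C] [IsCyclic C], Nat.card C = p ^ (j + 1) →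
        ∃ (A : Subgroup (FSZ.F p j)) (B : Subgroup C)
          (hA : A ≤ Subgroup.center (FSZ.F p j)) (hB : B ≤ Subgroup.center C) (φ : A ≃* B),
          ¬ FSZ.IsFSZ (p ^ j) (FSZ.CentralProduct hA hB φ)) := by
  refine ⟨FSZ.isFSZ_F hj, fun hp => ?_, fun hp C _ _ hC =>
    FSZ.exists_centralProduct_not_isFSZ hj hp C hC⟩
  have hA := FSZ.zpowers_cent_le_center (p := p) hj 1 1
  have hN : (Subgroup.zpowers (FSZ.cent p j 1 1)).Normal := ⟨fun x hx g => by
    rwa [Subgroup.mem_center_iff.1 (hA hx) g, mul_inv_cancel_right]⟩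
  refine ⟨Subgroup.zpowers (FSZ.cent p j 1 1), hN, hA, ⟨mulEquivOfPrimeCardEq (p := p)
    (FSZ.card_zpowers_cent hj one_ne_zero) ?_⟩, FSZ.exists_quotient_mulEquiv hj hp.le,
    FSZ.not_isFSZ_quotient hj hp⟩
  rw [Nat.card_congr Multiplicative.toAdd, Nat.card_zmod]
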